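/- Let $d\in\mathbb{N}$, let $\mathcal{X}=\prod_{i=1}^d[a_i,a_i+s]\subset\mathbb{R}^d$ with $s>0$ be a hypercube, let $\ell>0$, and let $k(x,x')=\exp\!\big(-\|x-x'\|^2/(2\ell^2)\big)$ be the squared exponential kernel on $\mathcal{X}$, with reproducing kernel Hilbert space $\mathcal{H}_k$. For a finite set $A\subset\mathcal{X}$ of design points and an objective $f\in\mathcal{H}_k$, let $$\mu_A(x)=k_A(x)^\top K_A^{-1}F_A,\qquad \sigma_A(x)=\sqrt{k(x,x)-k_A(x)^\top K_A^{-1}k_A(x)},$$ where $k_A(x)=(k(x,p))_{p\in A}$, $K_A=(k(p,q))_{p,q\in A}$ and $F_A=(f(p))_{p\in A}$. Noise-free GP-UCB with constant weight $\beta_t=\|f\|_{\mathcal{H}_k}^2$ and finite (possibly empty) initial design $X_0\subset\mathcal{X}$ selects, for $t=1,\dots,T$, $$x_t\in\arg\max_{x\in\mathcal{X}}\Big(\mu_{X_{t-1}}(x)+\beta_t^{1/2}\,\sigma_{X_{t-1}}(x)\Big),\qquad X_t=X_{t-1}\cup\{x_t\},$$ with ties broken arbitrarily. Then every $f\in\mathcal{H}_k$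 attains its maximum $f^*=\max_{\mathcal{X}}f$, and there is a constant $C$, depending only on $d$, $\mathcal{X}$ and $\ell$, such that for every $f\in\mathcal{H}_k$, every finite initial design $X_0$, every $T\ge 2$ and all points $x_1,\dots,x_T$ selected in this way, the cumulative regret $R_T=\sum_{t=1}^T\big(f^*-f(x_t)\big)$ and the simple regret $S_T=f^*-\max_{1\le t\le T}f(x_t)$ satisfy $$R_T\le C\,\|f\|_{\mathcal{H}_k}\,T^{1/2}\log^{d/2}T,\qquad S_T\le C\,\|f\|_{\mathcal{H}_k}\,T^{-1/2}\log^{d/2}T.$$ In particular $R_T=\mathcal{O}(T^{1/2}\log^{d/2}T)$ and $S_T=\mathcal{O}(T^{-1/2}\log^{d/2}T)$. -/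

import Mathlib

/-- The axis-parallel `d`-dimensional hypercube with lower corner `a` and side length `s`. -/
def hypercube {d : ℕ} (a : EuclideanSpace ℝ (Fin d)) (s : ℝ) : Set (EuclideanSpace ℝ (Fin d)) :=
  {x | ∀ i, a i ≤ x i ∧ x i ≤ a i + s}

/-- The squared exponential kernel with lengthscale `ℓ`. -/
noncomputable def sqExpKernel {d : ℕ} (ℓ : ℝ) (x y : EuclideanSpace ℝ (Fin d)) : ℝ :=
  Real.exp (-‖x - y‖ ^ 2 / (2 * ℓ ^ 2))

/-- The squared exponential kernel with lengthscale `ℓ`, restricted to a hypercube. -/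
noncomputable def cubeKernel {d : ℕ} (a : EuclideanSpace ℝ (Fin d)) (s ℓ : ℝ)
    (x y : hypercube a s) : ℝ :=
  sqExpKernel ℓ x.1 y.1

namespace GPUCB

section

variable {X : Type*}

/-- The kernel matrix of the (pairwise distinct) points of a finite design `A`. -/
def gram (k : X → X → ℝ) (A : Finset X) : Matrix A A ℝ :=
  Matrix.of fun i j => k i j

/-- The vector of the values `k x p` for the design points `p ∈ A`. -/
def kernelVec (k : X → X → ℝ) (A : Finset X) (x : X) : A → ℝ :=
  fun p => k x p

open Classical in
/-- Noise-free posterior mean at `x`, given the observations `F p` at the design points `p ∈ A`. -/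
noncomputable def postMean (k : X → X → ℝ) (A : Finset X) (F : A → ℝ) (x : X) : ℝ :=
  kernelVec k A x ⬝ᵥ Matrix.mulVec (gram k A)⁻¹ F

open Classical in
/-- Noise-free posterior variance at `x`, given the design `A`. -/
noncomputable def postVar (k : X → X → ℝ) (A : Finset X) (x : X) : ℝ :=
  k x x - kernelVec k A x ⬝ᵥ Matrix.mulVec (gram k A)⁻¹ (kernelVec k A x)

/-- Noise-free posterior standard deviation at `x`, given the design `A`. -/
noncomputable def postStd (k : X → X → ℝ) (A : Finset X) (x : X) : ℝ :=
  Real.sqrt (postVar k A x)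

/-- The upper confidence bound at `x` with weight `β`, after the objective `f` has been observed
without noise on the design `A`. -/
noncomputable def acquisition (k : X → X → ℝ) (f : X → ℝ) (A : Finset X) (β : ℝ) (x : X) : ℝ :=
  postMean k A (fun p => f p) x + Real.sqrt β * postStd k A x

open Classical in
/-- The set of all points observed in the first `t` iterations: the initial design `X₀` together
with the query points `x 1, …, x t` (the value `x 0` is not used). -/
noncomputable def design (X₀ : Finset X) (x : ℕ → X) : ℕ → Finset X
  | 0 => X₀
  | t + 1 => insert (x (t + 1)) (design X₀ x t)

/-- `x 1, …, x T` are the query points of `T` iterations of GP-UCB with noise-free observations of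
`f`, initial design `X₀` and weights `β`: the point `x t` maximizes, over the whole domain, the
upper confidence bound built from the first `t - 1` iterations. Ties are broken arbitrarily. -/
def IsRun (k : X → X → ℝ) (f : X → ℝ) (X₀ : Finset X) (β : ℕ → ℝ) (T : ℕ) (x : ℕ → X) : Prop :=
  ∀ t, 1 ≤ t → t ≤ T → ∀ z : X,
    acquisition k f (design X₀ x (t - 1)) (β t) z ≤
      acquisition k f (design X₀ x (t - 1)) (β t) (x t)

/-- The optimal value `f* = sup f` of the objective. -/
noncomputable def optValue (f : X → ℝ) : ℝ := ⨆ z, f z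

/-- The cumulative regret `R_T = ∑_{t = 1}^T (f* - f (x t))`. -/
noncomputable def cumRegret (f : X → ℝ) (x : ℕ → X) (T : ℕ) : ℝ :=
  ∑ t ∈ Finset.Icc 1 T, (optValue f - f (x t))

/-- The simple regret `S_T = f* - max_{1 ≤ t ≤ T} f (x t)`. -/
noncomputable def simpleRegret (f : X → ℝ) (x : ℕ → X) (T : ℕ) : ℝ :=
  optValue f - ⨆ t : Finset.Icc 1 T, f (x t)

end

end GPUCB

/-! The posterior mean misses `f` by at most `‖f‖` times the posterior deviation `σ`, so each query
has regret at most `2‖f‖σ` (`sub_le_two_mul_postStd`). By Cauchy–Schwarz it remains to bound the sum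
of the posterior variances by a multiple of `log T ^ d`; this holds for every sequence of points,
chosen by GP-UCB or not.

Each variance is the squared norm of the part of a unit feature vector orthogonal to the features of
the current design, and these residuals are mutually orthogonal. Taylor expansion of the kernel puts
all features, up to squared error `ε = O(e⁻ⁿ)` on the cube, in a span of `n ^ d` coordinate vectors.
Bessel's inequality for the normalized residuals bounds the sum by `2 n ^ d + 2 T ε`
(`sum_postVar_design_le`), and `n = ⌈log T⌉` concludes (`exists_sum_postVar_le`). -/

theorem hasSum_mul_real {ι κ : Type*} {f : ι → ℝ} {g : κ → ℝ} {a b : ℝ}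
    (hf : HasSum f a) (hg : HasSum g b) :
    HasSum (fun p : ι × κ => f p.1 * g p.2) (a * b) :=
  hf.mul hg (summable_mul_of_summable_norm hf.summable.norm hg.summable.norm)

/-- A product of convergent series, as a series over all multi-indices. -/
theorem hasSum_prod_fin {d : ℕ} {g : Fin d → ℕ → ℝ} {S : Fin d → ℝ}
    (h : ∀ i, HasSum (g i) (S i)) :
    HasSum (fun α : Fin d → ℕ => ∏ i, g i (α i)) (∏ i, S i) := by
  induction d with
  | zero => simp
  | succ d ih =>
    rw [Fin.prod_univ_succ S]
    refine ((Fin.consEquiv fun _ : Fin (d + 1) => ℕ).hasSum_iff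
      (f := fun α : Fin (d + 1) → ℕ => ∏ i, g i (α i))).1 ?_
    have htail := ih (g := fun i => g i.succ) (S := fun i => S i.succ) fun i => h i.succ
    have hmul := hasSum_mul_real (h 0) htail
    refine hmul.congr_fun fun p => ?_
    simp [Fin.prod_univ_succ, Fin.consEquiv]

/-! ### Taylor features of the squared exponential kernel -/

namespace SqExp

/-- The coordinate, at the multi-index `α`, of the feature map of the squared exponential kernel. -/
noncomputable def featureCoord {d : ℕ} (ℓ : ℝ) (x : EuclideanSpace ℝ (Fin d)) (α : Fin d → ℕ) : ℝ :=
  ∏ i, Real.exp (-(x i) ^ 2 / (2 * ℓ ^ 2)) * (x i / ℓ) ^ α i / √((α i).factorial)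

/-- Taylor series of the exponential in each coordinate. The parameter `c` makes this a generating
function in the total degree: `c = 1` yields the kernel, `c = e` the tail bound. -/
theorem hasSum_featureCoord_mul_pow {d : ℕ} (ℓ c : ℝ) (x y : EuclideanSpace ℝ (Fin d)) :
    HasSum (fun α => featureCoord ℓ x α * featureCoord ℓ y α * ∏ i, c ^ α i)
      (∏ i, Real.exp (-((x i) ^ 2 + (y i) ^ 2) / (2 * ℓ ^ 2) + c * (x i * y i) / ℓ ^ 2)) := by
  have h (i : Fin d) := (NormedSpace.expSeries_div_hasSum_exp (c * (x i * y i) / ℓ ^ 2)).mul_left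
    (Real.exp (-((x i) ^ 2 + (y i) ^ 2) / (2 * ℓ ^ 2)))
  simp only [← Real.exp_eq_exp_ℝ, ← Real.exp_add] at h
  convert hasSum_prod_fin h using 2 with α
  simp only [featureCoord, ← Finset.prod_mul_distrib]
  refine Finset.prod_congr rfl fun i _ => ?_
  have hs : √((α i).factorial : ℝ) * √((α i).factorial : ℝ) = (α i).factorial :=
    Real.mul_self_sqrt (by positivity)
  have he : Real.exp (-((x i) ^ 2 + (y i) ^ 2) / (2 * ℓ ^ 2)) =
      Real.exp (-(x i) ^ 2 / (2 * ℓ ^ 2)) * Real.exp (-(y i) ^ 2 / (2 * ℓ ^ 2)) := by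
    rw [← Real.exp_add]; congr 1; ring
  have hp : (c * (x i * y i) / ℓ ^ 2) ^ α i = (x i / ℓ) ^ α i * (y i / ℓ) ^ α i * c ^ α i := by
    rw [← mul_pow, ← mul_pow]; congr 1; ring
  rw [he, hp, div_mul_div_comm, hs]
  ring

theorem hasSum_featureCoord_mul {d : ℕ} (ℓ : ℝ) (x y : EuclideanSpace ℝ (Fin d)) :
    HasSum (fun α => featureCoord ℓ x α * featureCoord ℓ y α) (sqExpKernel ℓ x y) := by
  convert hasSum_featureCoord_mul_pow ℓ 1 x y using 1
  · simp
  · rw [sqExpKernel, ← Real.exp_sum, EuclideanSpace.norm_sq_eq, ← Finset.sum_neg_distrib,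
      Finset.sum_div]
    congr 1
    refine Finset.sum_congr rfl fun i _ => ?_
    simp only [PiLp.sub_apply, Real.norm_eq_abs, sq_abs]
    rcases eq_or_ne ℓ 0 with rfl | hℓ
    · simp
    · field_simp
      ring

theorem memℓp_featureCoord {d : ℕ} (ℓ : ℝ) (x : EuclideanSpace ℝ (Fin d)) :
    Memℓp (featureCoord ℓ x) 2 := by
  refine memℓp_gen ?_
  simpa [pow_two] using (hasSum_featureCoord_mul ℓ x x).summable

/-- The feature map of the squared exponential kernel, with values in a sequence space. -/
noncomputable def feature {d : ℕ} (ℓ : ℝ) (x : EuclideanSpace ℝ (Fin d)) :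
    lp (fun _ : Fin d → ℕ => ℝ) 2 :=
  ⟨featureCoord ℓ x, memℓp_featureCoord ℓ x⟩

@[simp]
theorem feature_apply {d : ℕ} (ℓ : ℝ) (x : EuclideanSpace ℝ (Fin d)) (α : Fin d → ℕ) :
    feature ℓ x α = featureCoord ℓ x α := rfl

theorem inner_feature {d : ℕ} (ℓ : ℝ) (x y : EuclideanSpace ℝ (Fin d)) :
    inner ℝ (feature ℓ x) (feature ℓ y) = sqExpKernel ℓ x y := by
  refine (lp.hasSum_inner (feature ℓ x) (feature ℓ y)).unique ?_
  simpa [mul_comm] using hasSum_featureCoord_mul ℓ x y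

theorem sqExpKernel_self {d : ℕ} (ℓ : ℝ) (x : EuclideanSpace ℝ (Fin d)) :
    sqExpKernel ℓ x x = 1 := by
  simp [sqExpKernel]

theorem norm_feature {d : ℕ} (ℓ : ℝ) (x : EuclideanSpace ℝ (Fin d)) : ‖feature ℓ x‖ = 1 := by
  have h := inner_feature ℓ x x
  rw [sqExpKernel_self, real_inner_self_eq_norm_sq] at h
  nlinarith [norm_nonneg (feature ℓ x)]

/-- The features of pairwise distinct points are linearly independent. -/
theorem linearIndependent_feature {d : ℕ} {ℓ : ℝ} (hℓ : ℓ ≠ 0) {ι : Type*} [Fintype ι]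
    {x : ι → EuclideanSpace ℝ (Fin d)} (hx : Function.Injective x) :
    LinearIndependent ℝ fun i => feature ℓ (x i) := by
  classical
  rw [Fintype.linearIndependent_iff]
  intro c hc
  set w : ι → ℝ := fun i => ∏ j, Real.exp (-(x i j) ^ 2 / (2 * ℓ ^ 2)) with hw
  have hmon (α : Fin d → ℕ) : ∑ i, c i * w i * ∏ j, (x i j / ℓ) ^ α j = 0 := by
    have h := congrArg (fun v : lp (fun _ : Fin d → ℕ => ℝ) 2 => v α) hc
    have hpos : (∏ j, √((α j).factorial : ℝ)) ≠ 0 := by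
      refine Finset.prod_ne_zero_iff.2 fun j _ => ?_
      positivity
    simp only [lp.coeFn_sum, lp.coeFn_smul, Finset.sum_apply, Pi.smul_apply, feature_apply,
      featureCoord, Finset.prod_div_distrib, Finset.prod_mul_distrib, smul_eq_mul,
      lp.coeFn_zero, Pi.zero_apply] at h
    rw [← mul_left_inj' (inv_ne_zero hpos), zero_mul, ← h, Finset.sum_mul]
    refine Finset.sum_congr rfl fun i _ => ?_
    simp only [hw]
    ring
  have hpoly (p : MvPolynomial (Fin d) ℝ) :
      ∑ i, c i * w i * MvPolynomial.eval (fun j => x i j / ℓ) p = 0 := by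
    simp only [MvPolynomial.eval_eq', Finset.mul_sum]
    rw [Finset.sum_comm]
    refine Finset.sum_eq_zero fun α _ => ?_
    have h := hmon α
    calc _ = p.coeff α * ∑ i, c i * w i * ∏ j, (x i j / ℓ) ^ α j := by
          rw [Finset.mul_sum]
          exact Finset.sum_congr rfl fun i _ => by ring
      _ = 0 := by rw [h, mul_zero]
  intro i
  -- This polynomial vanishes at every rescaled point except the `i`-th, which isolates `c i`.
  have h := hpoly (∏ k ∈ Finset.univ.erase i,
    ∑ j, (MvPolynomial.X j - MvPolynomial.C (x k j / ℓ)) ^ 2)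
  simp only [map_prod, map_sum, map_pow, map_sub, MvPolynomial.eval_X, MvPolynomial.eval_C] at h
  rw [Finset.sum_eq_single i] at h
  · have hw0 : w i ≠ 0 := Finset.prod_ne_zero_iff.2 fun j _ => (Real.exp_pos _).ne'
    have hprod : ∏ k ∈ Finset.univ.erase i, ∑ j, (x i j / ℓ - x k j / ℓ) ^ 2 ≠ 0 := by
      refine Finset.prod_ne_zero_iff.2 fun k hk h0 => (Finset.ne_of_mem_erase hk).symm (hx ?_)
      rw [Finset.sum_eq_zero_iff_of_nonneg fun j _ => sq_nonneg _] at h0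
      ext j
      have hj := h0 j (Finset.mem_univ j)
      rw [sq_eq_zero_iff, sub_eq_zero, div_left_inj' hℓ] at hj
      exact hj
    simpa [hw0, hprod] using h
  · intro k _ hki
    rw [Finset.prod_eq_zero (Finset.mem_erase.2 ⟨hki, Finset.mem_univ k⟩), mul_zero]
    simp
  · simp

/-- Exponential decay of the energy of a feature outside a cube of multi-indices. -/
theorem one_sub_sum_featureCoord_sq_le {d : ℕ} (ℓ : ℝ) (x : EuclideanSpace ℝ (Fin d)) (n : ℕ) :
    1 - ∑ α ∈ Fintype.piFinset fun _ : Fin d => Finset.range n, featureCoord ℓ x α ^ 2 ≤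
      Real.exp ((Real.exp 1 - 1) * ‖x‖ ^ 2 / ℓ ^ 2) * Real.exp (-n) := by
  set J := Fintype.piFinset fun _ : Fin d => Finset.range n
  have h1 : HasSum (fun α => featureCoord ℓ x α ^ 2) 1 := by
    simpa [pow_two, sqExpKernel_self] using hasSum_featureCoord_mul ℓ x x
  have h2 : HasSum (fun α => if α ∈ J then featureCoord ℓ x α ^ 2 else 0)
      (∑ α ∈ J, featureCoord ℓ x α ^ 2) := by
    rw [← Finset.sum_congr rfl fun α (hα : α ∈ J) => if_pos hα]
    exact hasSum_sum_of_ne_finset_zero fun α hα => if_neg hα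
  -- Chernoff's trick: the weight `exp (|α| - n)` is positive everywhere and at least 1 outside `J`,
  -- so the weighted series dominates the tail.
  have h3 := (hasSum_featureCoord_mul_pow ℓ (Real.exp 1) x x).mul_right (Real.exp (-n))
  have h4 : ∏ i, Real.exp (-((x i) ^ 2 + (x i) ^ 2) / (2 * ℓ ^ 2) +
      Real.exp 1 * (x i * x i) / ℓ ^ 2) = Real.exp ((Real.exp 1 - 1) * ‖x‖ ^ 2 / ℓ ^ 2) := by
    rw [← Real.exp_sum, EuclideanSpace.norm_sq_eq, Finset.mul_sum, Finset.sum_div]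
    congr 1
    refine Finset.sum_congr rfl fun i _ => ?_
    simp only [Real.norm_eq_abs, sq_abs]
    rcases eq_or_ne ℓ 0 with rfl | hℓ
    · simp
    · field_simp
      ring
  rw [h4] at h3
  refine hasSum_le (fun α => ?_) (h1.sub h2) h3
  by_cases hα : α ∈ J
  · simp only [hα, if_true, sub_self, ← pow_two]
    positivity
  · simp only [hα, if_false, sub_zero, ← pow_two]
    have hex : ∃ i, n ≤ α i := by
      by_contra! hcon
      exact hα (Fintype.mem_piFinset.2 fun i => Finset.mem_range.2 (hcon i))
    obtain ⟨i, hi⟩ := hex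
    have hsum : (n : ℝ) ≤ ∑ i, (α i : ℝ) :=
      le_trans (by exact_mod_cast hi)
        (Finset.single_le_sum (f := fun i => (α i : ℝ)) (fun _ _ => by positivity)
          (Finset.mem_univ i))
    have hone : 1 ≤ (∏ i, Real.exp 1 ^ α i) * Real.exp (-n) := by
      simp only [← Real.exp_nat_mul, mul_one]
      rw [← Real.exp_sum, ← Real.exp_add]
      exact Real.one_le_exp (by linarith)
    rw [mul_assoc]
    exact le_mul_of_one_le_right (sq_nonneg _) hone

end SqExp

/-! ### Posterior quantities as orthogonal residuals in a feature space -/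

namespace GPUCB

section

open Matrix

variable {X G : Type*} [NormedAddCommGroup G] [InnerProductSpace ℝ G]

open Classical in
/-- The weights of the interpolant of the kernel section at `x` on the design `A`. -/
noncomputable def interpWeight (k : X → X → ℝ) (A : Finset X) (x : X) : A → ℝ :=
  (gram k A)⁻¹ *ᵥ kernelVec k A x

/-- The difference between the feature `Ψ x` and its interpolant on the design `A`. -/
noncomputable def residual (k : X → X → ℝ) (Ψ : X → G) (A : Finset X) (x : X) : G :=
  Ψ x - ∑ p : A, interpWeight k A x p • Ψ p

theorem residual_sub_mem_span (k : X → X → ℝ) (Ψ : X → G) (A : Finset X) (x : X) :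
    Ψ x - residual k Ψ A x ∈ Submodule.span ℝ (Ψ '' A) := by
  rw [residual, sub_sub_cancel]
  exact Submodule.sum_mem _ fun p _ =>
    Submodule.smul_mem _ _ (Submodule.subset_span ⟨p, p.2, rfl⟩)

/-- A kernel matrix of linearly independent features is positive definite. -/
theorem posDef_gram {k : X → X → ℝ} {Ψ : X → G} (hΨ : ∀ x y, inner ℝ (Ψ x) (Ψ y) = k x y)
    {A : Finset X} (hA : LinearIndependent ℝ fun p : A => Ψ p) : (gram k A).PosDef := by
  have h : gram k A = Matrix.gram ℝ fun p : A => Ψ p := by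
    ext i j
    simp [gram, hΨ]
  rw [h]
  exact ((Matrix.posDef_gram_iff_linearIndependent).2 hA)

variable {k : X → X → ℝ} {Ψ : X → G} {A : Finset X}

open Classical in
/-- The residual is orthogonal to the features of the design points. -/
theorem inner_residual_eq_zero (hΨ : ∀ x y, inner ℝ (Ψ x) (Ψ y) = k x y)
    (hA : (gram k A).PosDef) (x : X) {q : X} (hq : q ∈ A) :
    inner ℝ (Ψ q) (residual k Ψ A x) = 0 := by
  have hsymm (x y : X) : k x y = k y x := by rw [← hΨ, ← hΨ, real_inner_comm]
  have h : (gram k A *ᵥ interpWeight k A x) ⟨q, hq⟩ = k x q := by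
    rw [interpWeight, mulVec_mulVec, mul_nonsing_inv _ ((isUnit_iff_isUnit_det _).1 hA.isUnit),
      one_mulVec, kernelVec]
  rw [residual, inner_sub_right, inner_sum, hΨ, sub_eq_zero, hsymm q x, ← h]
  simp only [mulVec, dotProduct, gram, of_apply, inner_smul_right, hΨ]
  exact Finset.sum_congr rfl fun p _ => mul_comm _ _

theorem inner_residual_eq_zero_of_mem_span (hΨ : ∀ x y, inner ℝ (Ψ x) (Ψ y) = k x y)
    (hA : (gram k A).PosDef) (x : X) {v : G} (hv : v ∈ Submodule.span ℝ (Ψ '' A)) :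
    inner ℝ v (residual k Ψ A x) = 0 := by
  induction hv using Submodule.span_induction with
  | mem v hv =>
    obtain ⟨q, hq, rfl⟩ := hv
    exact inner_residual_eq_zero hΨ hA x hq
  | zero => exact inner_zero_left _
  | add u v _ _ hu hv => rw [inner_add_left, hu, hv, add_zero]
  | smul c v _ hv => rw [inner_smul_left, hv, mul_zero]

theorem inner_feature_residual (hΨ : ∀ x y, inner ℝ (Ψ x) (Ψ y) = k x y)
    (hA : (gram k A).PosDef) (x : X) :
    inner ℝ (Ψ x) (residual k Ψ A x) = ‖residual k Ψ A x‖ ^ 2 := by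
  have h := inner_residual_eq_zero_of_mem_span hΨ hA x (residual_sub_mem_span k Ψ A x)
  rw [inner_sub_left, sub_eq_zero] at h
  rw [h, real_inner_self_eq_norm_sq]

/-- The posterior variance is the squared norm of the residual. -/
theorem postVar_eq_norm_sq (hΨ : ∀ x y, inner ℝ (Ψ x) (Ψ y) = k x y)
    (hA : (gram k A).PosDef) (x : X) : postVar k A x = ‖residual k Ψ A x‖ ^ 2 := by
  rw [← inner_feature_residual hΨ hA x, residual, inner_sub_right, inner_sum, hΨ, postVar]
  simp only [dotProduct, inner_smul_right, hΨ, interpWeight, kernelVec]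
  congr 1
  exact Finset.sum_congr rfl fun p _ => mul_comm _ _

theorem postStd_eq_norm (hΨ : ∀ x y, inner ℝ (Ψ x) (Ψ y) = k x y)
    (hA : (gram k A).PosDef) (x : X) : postStd k A x = ‖residual k Ψ A x‖ := by
  rw [postStd, postVar_eq_norm_sq hΨ hA, Real.sqrt_sq (norm_nonneg _)]

/-- The error of the posterior mean is bounded by the posterior standard deviation. -/
theorem abs_sub_postMean_le (hΨ : ∀ x y, inner ℝ (Ψ x) (Ψ y) = k x y)
    (hA : (gram k A).PosDef) {f : X → ℝ} {g : G} (hf : ∀ x, f x = inner ℝ g (Ψ x)) (x : X) :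
    |f x - postMean k A (fun p => f p) x| ≤ ‖g‖ * postStd k A x := by
  classical
  have hsymm : (gram k A)ᵀ = gram k A := by
    ext i j
    simp only [gram, transpose_apply, of_apply]
    rw [← hΨ, ← hΨ, real_inner_comm]
  have h : f x - postMean k A (fun p => f p) x = inner ℝ g (residual k Ψ A x) := by
    rw [residual, inner_sub_right, inner_sum, ← hf, postMean, dotProduct_mulVec,
      ← mulVec_transpose, transpose_nonsing_inv, hsymm]
    simp only [inner_smul_right, ← hf, dotProduct]
    rfl
  rw [h, postStd_eq_norm hΨ hA]
  exact abs_real_inner_le_norm _ _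

/-- The instantaneous regret of a maximizer of the upper confidence bound. -/
theorem sub_le_two_mul_postStd (hΨ : ∀ x y, inner ℝ (Ψ x) (Ψ y) = k x y)
    (hA : (gram k A).PosDef) {f : X → ℝ} {g : G} (hf : ∀ x, f x = inner ℝ g (Ψ x)) {x z : X}
    (hx : acquisition k f A (‖g‖ ^ 2) z ≤ acquisition k f A (‖g‖ ^ 2) x) :
    f z - f x ≤ 2 * ‖g‖ * postStd k A x := by
  -- The chain is `f z ≤ UCB z ≤ UCB x ≤ f x + 2‖g‖σ(x)`.
  have h1 := (abs_le.1 (abs_sub_postMean_le hΨ hA hf z)).2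
  have h2 := (abs_le.1 (abs_sub_postMean_le hΨ hA hf x)).1
  simp only [acquisition, Real.sqrt_sq (norm_nonneg g)] at hx
  linarith

theorem design_mono (X₀ : Finset X) (x : ℕ → X) : Monotone (design X₀ x) := by
  classical
  refine monotone_nat_of_le_succ fun t => ?_
  rw [design]
  exact Finset.subset_insert _ _

theorem mem_design (X₀ : Finset X) (x : ℕ → X) {s t : ℕ} (hs : 1 ≤ s) (hst : s ≤ t) :
    x s ∈ design X₀ x t := by
  classical
  refine design_mono X₀ x hst ?_
  obtain ⟨s, rfl⟩ := Nat.exists_eq_add_of_le' hs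
  rw [design]
  exact Finset.mem_insert_self _ _

/-- If the features are approximated up to the squared error `ε` in the span of a finite
orthonormal family, then the posterior variances at the points of any sequence have a sum bounded
by the size of that family. -/
theorem sum_postVar_design_le (hΨ : ∀ x y, inner ℝ (Ψ x) (Ψ y) = k x y)
    (hk : ∀ A : Finset X, (gram k A).PosDef) (hnorm : ∀ x, ‖Ψ x‖ = 1)
    {ι : Type*} {v : ι → G} (hv : Orthonormal ℝ v) (J : Finset ι) {ε : ℝ}
    (hε : ∀ x, 1 - ∑ j ∈ J, inner ℝ (v j) (Ψ x) ^ 2 ≤ ε)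
    (X₀ : Finset X) (x : ℕ → X) (T : ℕ) :
    ∑ t ∈ Finset.Icc 1 T, postVar k (design X₀ x (t - 1)) (x t) ≤ 2 * J.card + 2 * T * ε := by
  classical
  set ρ : ℕ → G := fun t => residual k Ψ (design X₀ x (t - 1)) (x t) with hρ
  -- Zero residuals, as for repeated points, cannot be normalized but contribute no variance.
  set I := (Finset.Icc 1 T).filter fun t => ρ t ≠ 0 with hI
  have hI0 (t : I) : ‖ρ t‖ ≠ 0 := norm_ne_zero_iff.2 (Finset.mem_filter.1 t.2).2
  have hI1 (t : I) : 1 ≤ (t : ℕ) := (Finset.mem_Icc.1 (Finset.mem_filter.1 t.2).1).1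
  -- The residual at an earlier time `s` lies in the span of the design preceding `t`, which already
  -- contains `x s`.
  have horth {s t : ℕ} (hs : 1 ≤ s) (hst : s < t) : inner ℝ (ρ s) (ρ t) = 0 := by
    refine inner_residual_eq_zero_of_mem_span hΨ (hk _) _ ?_
    have hmem : Ψ (x s) ∈ Submodule.span ℝ (Ψ '' design X₀ x (t - 1)) :=
      Submodule.subset_span ⟨x s, mem_design X₀ x hs (by omega), rfl⟩
    have hsub := Submodule.span_mono (R := ℝ) (Set.image_mono (f := Ψ)
      (Finset.coe_subset.2 (design_mono X₀ x (show s - 1 ≤ t - 1 by omega))))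
      (residual_sub_mem_span k Ψ (design X₀ x (s - 1)) (x s))
    simpa [hρ] using Submodule.sub_mem _ hmem hsub
  set e : I → G := fun t => ‖ρ t‖⁻¹ • ρ t with he
  have heorth : Orthonormal ℝ e := by
    refine ⟨fun t => ?_, fun s t hst => ?_⟩
    · simp [he, norm_smul, hI0 t]
    · have h0 : inner ℝ (ρ s) (ρ t) = 0 := by
        rcases lt_or_gt_of_ne (Subtype.coe_ne_coe.2 hst) with h | h
        · exact horth (hI1 s) h
        · rw [real_inner_comm]
          exact horth (hI1 t) h
      simp [he, inner_smul_left, inner_smul_right, h0]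
  have hstep (t : I) : postVar k (design X₀ x (t - 1)) (x t) ≤
      2 * ∑ j ∈ J, inner ℝ (e t) (v j) ^ 2 + 2 * ε := by
    set c : ι → ℝ := fun j => inner ℝ (v j) (Ψ (x t)) with hc
    set P : G := ∑ j ∈ J, c j • v j with hP
    have hvar : postVar k (design X₀ x (t - 1)) (x t) = inner ℝ (Ψ (x t)) (e t) ^ 2 := by
      rw [postVar_eq_norm_sq hΨ (hk _), he, inner_smul_right,
        inner_feature_residual hΨ (hk _)]
      have := hI0 t
      simp only [hρ] at this ⊢
      field_simp
    have hcsum : ∑ j ∈ J, c j ^ 2 ≤ 1 := by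
      have h := hv.sum_inner_products_le (Ψ (x t)) (s := J)
      simpa [hnorm, hc] using h
    have hPc : inner ℝ P (Ψ (x t)) = ∑ j ∈ J, c j ^ 2 := by
      simp only [hP, sum_inner, inner_smul_left, hc]
      exact Finset.sum_congr rfl fun j _ => by simp [pow_two]
    have hPP : inner ℝ P P = ∑ j ∈ J, c j ^ 2 := by
      rw [hP, hv.inner_sum]
      exact Finset.sum_congr rfl fun j _ => by simp [pow_two]
    have hQ : ‖Ψ (x t) - P‖ ^ 2 ≤ ε := by
      have h := hε (x t)
      rw [norm_sub_sq_real, hnorm, real_inner_comm, hPc, ← real_inner_self_eq_norm_sq, hPP]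
      linarith
    have h1 : inner ℝ P (e t) ^ 2 ≤ ∑ j ∈ J, inner ℝ (e t) (v j) ^ 2 := by
      have h : inner ℝ P (e t) = ∑ j ∈ J, c j * inner ℝ (e t) (v j) := by
        rw [hP, sum_inner]
        refine Finset.sum_congr rfl fun j _ => ?_
        rw [inner_smul_left, real_inner_comm (v j) (e t)]
        rfl
      rw [h]
      refine (Finset.sum_mul_sq_le_sq_mul_sq _ _ _).trans ?_
      exact mul_le_of_le_one_left (Finset.sum_nonneg fun j _ => sq_nonneg _) hcsum
    have h2 : inner ℝ (Ψ (x t) - P) (e t) ^ 2 ≤ ε := by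
      refine le_trans ?_ hQ
      have h := abs_real_inner_le_norm (Ψ (x t) - P) (e t)
      rw [heorth.1 t, mul_one] at h
      exact sq_le_sq' (abs_le.1 h).1 (abs_le.1 h).2
    -- Splitting the feature into `P` and a remainder, `(u + v)² ≤ 2u² + 2v²` produces both factors
    -- 2.
    rw [hvar, ← sub_add_cancel (Ψ (x t)) P, inner_add_left]
    nlinarith [sq_nonneg (inner ℝ (Ψ (x t) - P) (e t) - inner ℝ P (e t))]
  have hε0 (y : X) : 0 ≤ ε := by
    have h := hv.sum_inner_products_le (Ψ y) (s := J)
    simp only [hnorm, Real.norm_eq_abs, sq_abs] at h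
    linarith [hε y]
  have hsum : ∑ t ∈ Finset.Icc 1 T, postVar k (design X₀ x (t - 1)) (x t) =
      ∑ t : I, postVar k (design X₀ x ((t : ℕ) - 1)) (x t) := by
    rw [Finset.sum_coe_sort I fun t => postVar k (design X₀ x (t - 1)) (x t), hI,
      Finset.sum_filter_of_ne]
    intro t _ ht h0
    exact ht (by rw [postVar_eq_norm_sq hΨ (hk _)]; simpa [hρ] using h0)
  have hcard : (I.card : ℝ) ≤ T := by
    exact_mod_cast (Finset.card_filter_le _ _).trans (by simp)
  rw [hsum]
  calc ∑ t : I, postVar k (design X₀ x ((t : ℕ) - 1)) (x t)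
      ≤ ∑ t : I, (2 * ∑ j ∈ J, inner ℝ (e t) (v j) ^ 2 + 2 * ε) :=
        Finset.sum_le_sum fun t _ => hstep t
    _ = 2 * ∑ j ∈ J, ∑ t : I, inner ℝ (e t) (v j) ^ 2 + I.card * (2 * ε) := by
        rw [Finset.sum_add_distrib, ← Finset.mul_sum, Finset.sum_comm]
        simp
    _ ≤ 2 * ∑ j ∈ J, 1 + T * (2 * ε) := by
        refine add_le_add (mul_le_mul_of_nonneg_left (Finset.sum_le_sum fun j _ => ?_) two_pos.le)
          (mul_le_mul_of_nonneg_right hcard (mul_nonneg two_pos.le (hε0 (x 0))))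
        -- Bessel with the roles exchanged: each unit vector `v j` is expanded in the residual
        -- directions.
        have h := heorth.sum_inner_products_le (v j) (s := Finset.univ)
        simpa [hv.1 j] using h
    _ = 2 * J.card + 2 * T * ε := by
        simp
        ring

end

end GPUCB

/-! ### The cube and the logarithmic variance bound -/

theorem isCompact_hypercube {d : ℕ} (a : EuclideanSpace ℝ (Fin d)) (s : ℝ) :
    IsCompact (hypercube a s) := by
  have h : hypercube a s = (EuclideanSpace.equiv (Fin d) ℝ).toHomeomorph ⁻¹'
      Set.univ.pi fun i => Set.Icc (a i) (a i + s) := by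
    ext x
    simp only [hypercube, Set.mem_ofPred_eq, Set.mem_preimage, Set.mem_univ_pi, Set.mem_Icc]
    rfl
  rw [h, Homeomorph.isCompact_preimage]
  exact isCompact_univ_pi fun i => isCompact_Icc

theorem nonempty_hypercube {d : ℕ} (a : EuclideanSpace ℝ (Fin d)) {s : ℝ} (hs : 0 ≤ s) :
    (hypercube a s).Nonempty :=
  ⟨a, fun i => ⟨le_rfl, by linarith⟩⟩

namespace SqExp

/-- Ensures that the matrix inverse in the posterior formulas is a genuine one for every design. -/
theorem posDef_gram_cubeKernel {d : ℕ} (a : EuclideanSpace ℝ (Fin d)) (s : ℝ) {ℓ : ℝ} (hℓ : ℓ ≠ 0)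
    (A : Finset (hypercube a s)) : (GPUCB.gram (cubeKernel a s ℓ) A).PosDef :=
  GPUCB.posDef_gram (Ψ := fun x : hypercube a s => feature ℓ x.1) (fun x y => inner_feature ℓ x.1 y.1)
    (linearIndependent_feature hℓ (x := fun p : A => p.1.1)
      (Subtype.val_injective.comp Subtype.val_injective))

theorem orthonormal_single (ι : Type*) [DecidableEq ι] :
    Orthonormal ℝ fun i : ι => (lp.single 2 i (1 : ℝ) : lp (fun _ : ι => ℝ) 2) := by
  rw [orthonormal_iff_ite]
  intro i j
  rw [lp.inner_single_left]
  simp [lp.single_apply, Pi.single_apply]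

/-- The posterior variances along any sequence of query points grow at most like `log ^ d`. -/
theorem exists_sum_postVar_le {d : ℕ} (a : EuclideanSpace ℝ (Fin d)) (s : ℝ) {ℓ : ℝ} (hℓ : ℓ ≠ 0) :
    ∃ C : ℝ, 0 ≤ C ∧ ∀ (X₀ : Finset (hypercube a s)) (x : ℕ → hypercube a s) (T : ℕ), 2 ≤ T →
      ∑ t ∈ Finset.Icc 1 T,
        GPUCB.postVar (cubeKernel a s ℓ) (GPUCB.design X₀ x (t - 1)) (x t) ≤
          C * Real.log T ^ d := by
  classical
  obtain ⟨R, hR⟩ := (isCompact_hypercube a s).isBounded.exists_norm_le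
  set M := Real.exp ((Real.exp 1 - 1) * R ^ 2 / ℓ ^ 2) with hM
  -- With `n = ⌈log T⌉` and `ε = M / T` the bound is `2 n ^ d + 2 M`. Since `T ≥ 2` gives `log T ≥ 1
  -- / 2`, both `n` and `1` are at most `3 log T`.
  refine ⟨2 * (1 + M) * 3 ^ d, by positivity, fun X₀ x T hT => ?_⟩
  have hT0 : (0 : ℝ) < T := by positivity
  have hlog : 1 / 2 ≤ Real.log T := by
    have h1 : Real.log 2 ≤ Real.log T := Real.log_le_log two_pos (by exact_mod_cast hT)
    linarith [Real.log_two_gt_d9]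
  set n := ⌈Real.log T⌉₊ with hn
  have hn1 : (n : ℝ) ≤ 3 * Real.log T := by
    linarith [Nat.ceil_lt_add_one (show 0 ≤ Real.log T by linarith)]
  have hexp : Real.exp (-n) ≤ (T : ℝ)⁻¹ := by
    rw [← Real.exp_log (inv_pos.2 hT0), Real.log_inv]
    exact Real.exp_le_exp.2 (neg_le_neg (Nat.le_ceil _))
  have h := GPUCB.sum_postVar_design_le (k := cubeKernel a s ℓ)
    (Ψ := fun x : hypercube a s => feature ℓ x.1) (fun x y => inner_feature ℓ x.1 y.1)
    (posDef_gram_cubeKernel a s hℓ) (fun x => norm_feature ℓ x.1)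
    (orthonormal_single (Fin d → ℕ)) (Fintype.piFinset fun _ : Fin d => Finset.range n)
    (ε := M * (T : ℝ)⁻¹) (fun x => ?_) X₀ x T
  · refine h.trans ?_
    have hpow : (n : ℝ) ^ d ≤ (3 * Real.log T) ^ d := by gcongr
    have hone : (1 : ℝ) ≤ (3 * Real.log T) ^ d := one_le_pow₀ (by linarith)
    have hM0 : 0 < M := Real.exp_pos _
    have hcancel : 2 * T * (M * (T : ℝ)⁻¹) = 2 * M := by field_simp
    rw [hcancel, Fintype.card_piFinset_const, Finset.card_range, Nat.cast_pow,
      mul_assoc _ ((3 : ℝ) ^ d), ← mul_pow]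
    nlinarith
  · simp only [lp.inner_single_left, feature_apply]
    simp only [RCLike.inner_apply, map_one, mul_one]
    refine (one_sub_sum_featureCoord_sq_le ℓ x.1 n).trans ?_
    refine mul_le_mul (Real.exp_le_exp.2 ?_) hexp (Real.exp_pos _).le (Real.exp_pos _).le
    have he : 0 ≤ Real.exp 1 - 1 := by linarith [Real.add_one_le_exp 1]
    have := hR x.1 x.2
    gcongr

end SqExp

/-! ### From variances to regret -/

namespace GPUCB

theorem simpleRegret_le {X : Type*} (f : X → ℝ) (x : ℕ → X) {T : ℕ} (hT : 0 < T) :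
    simpleRegret f x T ≤ cumRegret f x T / T := by
  have hT0 : (0 : ℝ) < T := by exact_mod_cast hT
  rw [le_div_iff₀ hT0, cumRegret]
  have h (t : ℕ) (ht : t ∈ Finset.Icc 1 T) : simpleRegret f x T ≤ optValue f - f (x t) := by
    have := le_ciSup (f := fun t : Finset.Icc 1 T => f (x t)) (Set.finite_range _).bddAbove ⟨t, ht⟩
    rw [simpleRegret]
    linarith
  have hsum := Finset.card_nsmul_le_sum _ _ _ h
  simp only [Nat.card_Icc, Nat.add_sub_cancel, nsmul_eq_mul] at hsum
  linarith

end GPUCB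

theorem mainTheorem1 {d : ℕ} (a : EuclideanSpace ℝ (Fin d)) (s : ℝ) (hs : 0 < s)
    (ℓ : ℝ) (hℓ : 0 < ℓ)
    {H : Type*} [NormedAddCommGroup H] [InnerProductSpace ℝ H] [CompleteSpace H]
    [RKHS ℝ H (hypercube a s) ℝ]
    (hH : ∀ x y : hypercube a s, RKHS.kernel H x y 1 = cubeKernel a s ℓ x y) :
    (∀ f : H, IsGreatest (Set.range f) (GPUCB.optValue f)) ∧
    ∃ C : ℝ, ∀ (f : H) (X₀ : Finset (hypercube a s)) (T : ℕ) (x : ℕ → hypercube a s),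
      2 ≤ T →
      GPUCB.IsRun (cubeKernel a s ℓ) f X₀ (fun _ => ‖f‖ ^ 2) T x →
      GPUCB.cumRegret f x T ≤
          C * ‖f‖ * ((T : ℝ) ^ (1 / 2 : ℝ) * Real.log T ^ ((d : ℝ) / 2)) ∧
        GPUCB.simpleRegret f x T ≤
          C * ‖f‖ * ((T : ℝ) ^ (-(1 / 2) : ℝ) * Real.log T ^ ((d : ℝ) / 2)) := by
  -- These features in `H` represent `f`, whereas the variance bound used sequence-space features;
  -- the two fit together because `postVar` depends only on the kernel.
  set Ψ : hypercube a s → H := fun x => RKHS.kerFun H x 1 with hΨdef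
  have hrep (f : H) (x : hypercube a s) : f x = inner ℝ f (Ψ x) := by
    simp [hΨdef]
  have hΨ (x y : hypercube a s) : inner ℝ (Ψ x) (Ψ y) = cubeKernel a s ℓ x y := by
    rw [real_inner_comm, ← hrep, hΨdef, RKHS.kerFun_apply, hH]
  have hgram := SqExp.posDef_gram_cubeKernel a s hℓ.ne'
  have hcont : Continuous Ψ := by
    have h (x y : hypercube a s) : dist (Ψ x) (Ψ y) = √(2 - 2 * cubeKernel a s ℓ x y) := by
      rw [dist_eq_norm, ← Real.sqrt_sq (norm_nonneg (Ψ x - Ψ y)), norm_sub_sq_real,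
        ← real_inner_self_eq_norm_sq, ← real_inner_self_eq_norm_sq, hΨ, hΨ, hΨ]
      simp only [cubeKernel, SqExp.sqExpKernel_self]
      congr 1
      ring
    rw [continuous_iff_continuousAt]
    intro y
    rw [ContinuousAt, tendsto_iff_dist_tendsto_zero]
    simp only [h]
    have hc : Continuous fun x : hypercube a s => √(2 - 2 * cubeKernel a s ℓ x y) := by
      unfold cubeKernel sqExpKernel
      fun_prop
    convert hc.tendsto y using 2
    simp [cubeKernel, SqExp.sqExpKernel_self]
  have hgreatest (f : H) : IsGreatest (Set.range f) (GPUCB.optValue f) := by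
    have : CompactSpace (hypercube a s) := isCompact_iff_compactSpace.1 (isCompact_hypercube a s)
    have : Nonempty (hypercube a s) := (nonempty_hypercube a hs.le).to_subtype
    have hf : Continuous f := by
      have h : (f : hypercube a s → ℝ) = fun x => inner ℝ f (Ψ x) := funext (hrep f)
      rw [h]
      fun_prop
    exact (isCompact_range hf).isGreatest_sSup (Set.range_nonempty _)
  refine ⟨hgreatest, ?_⟩
  obtain ⟨C, hC, hsum⟩ := SqExp.exists_sum_postVar_le a s hℓ.ne'
  refine ⟨2 * √C, fun f X₀ T x hT hrun => ?_⟩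
  have hT0 : (0 : ℝ) < T := by positivity
  have hlog : 0 ≤ Real.log T := Real.log_natCast_nonneg T
  obtain ⟨z, hz⟩ := (hgreatest f).1
  have hstep (t : ℕ) (ht : t ∈ Finset.Icc 1 T) : GPUCB.optValue f - f (x t) ≤
      2 * ‖f‖ * GPUCB.postStd (cubeKernel a s ℓ) (GPUCB.design X₀ x (t - 1)) (x t) := by
    rw [← hz]
    rw [Finset.mem_Icc] at ht
    exact GPUCB.sub_le_two_mul_postStd hΨ (hgram _) (hrep f) (hrun t ht.1 ht.2 z)
  have hstd : ∑ t ∈ Finset.Icc 1 T,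
      GPUCB.postStd (cubeKernel a s ℓ) (GPUCB.design X₀ x (t - 1)) (x t) ≤
        √C * ((T : ℝ) ^ (1 / 2 : ℝ) * Real.log T ^ ((d : ℝ) / 2)) := by
    have hrhs : √C * ((T : ℝ) ^ (1 / 2 : ℝ) * Real.log T ^ ((d : ℝ) / 2)) =
        √(T * (C * Real.log T ^ d)) := by
      have hroot : Real.log T ^ ((d : ℝ) / 2) = √(Real.log T ^ d) := by
        rw [Real.sqrt_eq_rpow, ← Real.rpow_natCast, ← Real.rpow_mul hlog]
        congr 1
        ring
      rw [Real.sqrt_mul hT0.le, Real.sqrt_mul hC, hroot, ← Real.sqrt_eq_rpow]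
      ring
    rw [hrhs]
    -- Cauchy–Schwarz turns the sum of deviations into `T` times the sum of variances.
    refine Real.le_sqrt_of_sq_le (sq_sum_le_card_mul_sum_sq.trans ?_)
    rw [Nat.card_Icc, Nat.add_sub_cancel]
    refine mul_le_mul_of_nonneg_left (le_trans (le_of_eq ?_) (hsum X₀ x T hT)) hT0.le
    refine Finset.sum_congr rfl fun t _ => Real.sq_sqrt ?_
    rw [GPUCB.postVar_eq_norm_sq hΨ (hgram _)]
    positivity
  have hcum : GPUCB.cumRegret f x T ≤
      2 * √C * ‖f‖ * ((T : ℝ) ^ (1 / 2 : ℝ) * Real.log T ^ ((d : ℝ) / 2)) := by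
    rw [GPUCB.cumRegret]
    refine (Finset.sum_le_sum hstep).trans ?_
    rw [← Finset.mul_sum]
    refine (mul_le_mul_of_nonneg_left hstd (by positivity)).trans (le_of_eq ?_)
    ring
  refine ⟨hcum, ?_⟩
  refine (GPUCB.simpleRegret_le f x (by omega)).trans ?_
  rw [div_le_iff₀ hT0]
  refine hcum.trans (le_of_eq ?_)
  have hpow : (T : ℝ) ^ (1 / 2 : ℝ) = (T : ℝ) ^ (-(1 / 2) : ℝ) * T := by
    rw [← Real.rpow_add_one hT0.ne']
    norm_num
  rw [hpow]
  ring
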